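/- Let $\mathbb{F}$ be a field, let $\mathbf{Vec}$ be the category of finite-dimensional $\mathbb{F}$-vector spaces, and let $\mathbf{ZZ}$ be the category whose objects are the integers and whose non-identity morphisms are exactly one morphism $i\to i-1$ and one morphism $i\to i+1$ for every even integer $i$. A zigzag persistence module is a functor $V\colon\mathbf{ZZ}\to\mathbf{Vec}$, that is, a diagram $$\cdots\to V_{-1}\leftarrow V_0\to V_1\leftarrow V_2\to\cdots$$ indexed by all of $\mathbb{Z}$. The direct sum of two zigzag persistence modules is taken pointwise, on objects and on morphisms. $V$ is decomposable if $V\cong U\oplus W$ for some non-zero zigzag persistence modules $U,W$, and indecomposable otherwise. For $a\le b$ in $\mathbb{Z}\cup\{\pm\infty\}$ let $I^{[a,b]}$ be the zigzag persistence module with $I^{[a,b]}_i=\mathbb{F}$ if $a\le i\le b$ and $I^{[a,b]}_i=0$ otherwise, in which every morphism between two non-zero spaces is the identity (and every other morphism is zero). **Theorem.** Let $V\colon\mathbf{ZZ}\to\mathbf{Vec}$ be an indecomposable zigzag persistence module. Then there are $a\le b$ in $\mathbb{Z}\cup\{\pm\infty\}$ such that $V\cong I^{[a,b]}$. (With these conventions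 the zero module counts as indecomposable, and it is $I^{[+\infty,+\infty]}$; if $V\ne 0$, then the interval $[a,b]$ necessarily contains an integer.) -/

import Mathlib

open CategoryTheory CategoryTheory.Limits

universe u

/-- The objects of the zigzag category: one object for every integer. -/
@[ext]
structure ZZ where
  idx : ℤ

/-- The zigzag category has, besides identities, exactly one morphism `i ⟶ i - 1` and exactly one
morphism `i ⟶ i + 1` for every even `i`. It is thin, and no two non-identity morphisms are
composable (their targets are odd), so it is given as a partial order. -/
instance : PartialOrder ZZ where
  le i j := i = j ∨ (Even i.idx ∧ (j.idx = i.idx - 1 ∨ j.idx = i.idx + 1))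
  le_refl i := Or.inl rfl
  le_trans := by
    rintro ⟨i⟩ ⟨j⟩ ⟨k⟩ h₁ h₂
    simp only [ZZ.mk.injEq, Int.even_iff] at *
    omega
  le_antisymm := by
    rintro ⟨i⟩ ⟨j⟩ h₁ h₂
    simp only [ZZ.mk.injEq, Int.even_iff] at *
    omega

theorem ZZ.le_def (i j : ZZ) :
    i ≤ j ↔ i = j ∨ (Even i.idx ∧ (j.idx = i.idx - 1 ∨ j.idx = i.idx + 1)) := Iff.rfl

/-- Infinite zigzag persistence modules: functors from the zigzag category to the category of
finite-dimensional vector spaces over `F`. -/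
abbrev ZigzagModule (F : Type u) [Field F] := ZZ ⥤ FGModuleCat.{u} F

namespace ZigzagModule

variable {F : Type u} [Field F]

/-- The direct sum `U ⊕ W`, defined pointwise on objects and on morphisms. -/
def directSum (U W : ZigzagModule F) : ZigzagModule F where
  obj i := FGModuleCat.of F (U.obj i × W.obj i)
  map α := FGModuleCat.ofHom (LinearMap.prodMap (U.map α).hom.hom (W.map α).hom.hom)
  map_id i := by
    ext x <;> simp <;> rfl
  map_comp α β := by
    ext x <;> simp <;> rfl

/-- `V` is decomposable if it is isomorphic to a direct sum of two non-zero zigzag modules. -/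
def IsDecomposable (V : ZigzagModule F) : Prop :=
  ∃ U W : ZigzagModule F, ¬ IsZero U ∧ ¬ IsZero W ∧ Nonempty (V ≅ U.directSum W)

/-- `V` is indecomposable if it is not decomposable. -/
def IsIndecomposable (V : ZigzagModule F) : Prop := ¬ V.IsDecomposable

/-- The integer `i` lies in the interval `[a, b]`, where `a, b ∈ ℤ ∪ {-∞, +∞}`
(`⊥` is `-∞` and `⊤` is `+∞`). -/
def InInterval (a b : WithBot (WithTop ℤ)) (i : ZZ) : Prop :=
  a ≤ ((i.idx : WithTop ℤ) : WithBot (WithTop ℤ)) ∧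
    ((i.idx : WithTop ℤ) : WithBot (WithTop ℤ)) ≤ b

variable (F)

open Classical in
/-- The spaces of the interval module: `F` inside the interval, the zero space outside. -/
noncomputable def intervalObj (a b : WithBot (WithTop ℤ)) (i : ZZ) : FGModuleCat.{u} F :=
  if InInterval a b i then FGModuleCat.of F F else FGModuleCat.of F PUnit.{u + 1}

variable {F}

theorem intervalObj_of_mem {a b : WithBot (WithTop ℤ)} {i : ZZ} (h : InInterval a b i) :
    intervalObj F a b i = FGModuleCat.of F F := if_pos h

theorem intervalObj_of_not_mem {a b : WithBot (WithTop ℤ)} {i : ZZ} (h : ¬ InInterval a b i) :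
    intervalObj F a b i = FGModuleCat.of F PUnit.{u + 1} := if_neg h

theorem subsingleton_intervalObj {a b : WithBot (WithTop ℤ)} {i : ZZ} (h : ¬ InInterval a b i) :
    Subsingleton (intervalObj F a b i) := by
  rw [intervalObj_of_not_mem h]
  exact inferInstanceAs (Subsingleton PUnit)

variable (F)

open Classical in
/-- The maps of the interval module: the identity of `F` (through the equalities
`intervalObj F a b i = F` and `F = intervalObj F a b j`) if both `i` and `j` lie in the interval,
and zero otherwise. -/
noncomputable def intervalMap (a b : WithBot (WithTop ℤ)) (i j : ZZ) :
    intervalObj F a b i ⟶ intervalObj F a b j :=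
  if h : InInterval a b i ∧ InInterval a b j then
    eqToHom ((intervalObj_of_mem h.1).trans (intervalObj_of_mem h.2).symm)
  else 0

/-- The interval zigzag persistence module `I^{[a, b]}`. -/
noncomputable def interval (a b : WithBot (WithTop ℤ)) : ZigzagModule F where
  obj i := intervalObj F a b i
  map {i j} _ := intervalMap F a b i j
  map_id i := by
    by_cases h : InInterval a b i
    · simp [intervalMap, h]
    · have := subsingleton_intervalObj (F := F) h
      ext x
      exact Subsingleton.elim _ _
  map_comp {i j k} α β := by
    by_cases hi : InInterval a b i
    · by_cases hk : InInterval a b k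
      · by_cases hj : InInterval a b j
        · simp [intervalMap, hi, hj, hk]
        · exfalso
          have h₁ := leOfHom α
          have h₂ := leOfHom β
          rw [ZZ.le_def] at h₁ h₂
          rcases h₁ with rfl | ⟨e₁, h₁⟩
          · exact hj hi
          rcases h₂ with rfl | ⟨e₂, h₂⟩
          · exact hj hk
          rw [Int.even_iff] at e₁ e₂
          omega
      · have := subsingleton_intervalObj (F := F) hk
        ext x
        exact Subsingleton.elim _ _
    · simp [intervalMap, hi]

end ZigzagModule

/-!
An idempotent endomorphism of a zigzag module splits it as range plus kernel, so the only idempotent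
endomorphisms of an indecomposable module `V` are `0` and the identity
(`ZigzagModule.IsIndecomposable.idempotent_eq`). The proof constructs enough idempotents.

At each position `i`, push the subspaces `⊥` and `⊤` of the spaces to the left of `i` towards `i`, by
images and preimages along the structure maps. The results are totally ordered by inclusion and form
the left flag of `V.obj i`; the right flag is obtained in the same way (`ZigzagModule.Flag`). An
idempotent of `V.obj i` that preserves the left flag extends to the left by one step, to an idempotent
that preserves the left flag there (`ZigzagModule.exists_compatible_idempotent`). Hence it extends to
all of the left half, with no limit argument, because the flag already takes the whole infinite half
into account. The linear algebra behind a step is that every subspace of a finite-dimensional space is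
the range of a projection that preserves a given chain (`exists_projection_preserving_chain`).

If `V.obj i` is non-zero, some idempotent of rank one preserves both flags
(`exists_rank_one_idempotent_preserving_chains`), hence extends to an idempotent endomorphism of `V`.
This is not zero, so it is the identity, and `V.obj i` has dimension one. Truncation at a vanishing
structure map is idempotent too, so the support of `V` is an interval and the structure maps within it
are bijective. Generators of the spaces can then be chosen compatibly, outwards from one position, and
they identify `V` with an interval module.
-/

/-! ### Idempotents and chains of subspaces -/

section LinearAlgebra

variable {F U W : Type*} [Field F] [AddCommGroup U] [Module F U] [AddCommGroup W] [Module F W]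

/-- The induction behind `exists_projection_preserving_chain`: a complement of `T ⊓ X` in `X` adapted
to the members of `L` below `X` is found by enlarging one for the largest member of `L` properly
below `X`. -/
theorem exists_disjoint_adapted [FiniteDimensional F U] {L : Set (Submodule F U)}
    (hL : IsChain (· ≤ ·) L) (T X : Submodule F U) :
    ∃ C ≤ X, Disjoint C T ∧ X ≤ (T ⊓ X) ⊔ C ∧ ∀ Y ∈ L, Y ≤ X → Y ≤ (T ⊓ Y) ⊔ (C ⊓ Y) := by
  induction X using WellFoundedLT.induction with
  | ind X ih =>
  obtain ⟨C₀, hC₀X, hC₀T, hC₀⟩ : ∃ C₀ ≤ X, Disjoint C₀ T ∧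
      ∀ Y ∈ L, Y < X → Y ≤ (T ⊓ Y) ⊔ (C₀ ⊓ Y) := by
    by_cases hne : {Y | Y ∈ L ∧ Y < X}.Nonempty
    · obtain ⟨M, ⟨hML, hMX⟩, hM⟩ := WellFounded.has_min wellFounded_gt _ hne
      obtain ⟨C₀, h₁, h₂, -, h₄⟩ := ih M hMX
      refine ⟨C₀, h₁.trans hMX.le, h₂, fun Y hY hYX => h₄ Y hY ?_⟩
      rcases hL.total hY hML with h | h
      · exact h
      · exact (eq_or_lt_of_le h).elim (fun h => h.ge) fun h => (hM Y ⟨hY, hYX⟩ h).elim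
    · exact ⟨⊥, bot_le, disjoint_bot_left, fun Y hY hYX => (hne ⟨Y, hY, hYX⟩).elim⟩
  obtain ⟨D, hD⟩ := exists_isCompl (C₀ ⊔ T ⊓ X)
  have hX : X ≤ (C₀ ⊔ T ⊓ X) ⊔ D ⊓ X := by
    rw [← sup_inf_assoc_of_le D (sup_le hC₀X inf_le_right), hD.sup_eq_top, top_inf_eq]
  have hX' : X ≤ (T ⊓ X) ⊔ (C₀ ⊔ D ⊓ X) := by
    rwa [← sup_assoc, sup_comm (T ⊓ X)]
  refine ⟨C₀ ⊔ D ⊓ X, sup_le hC₀X inf_le_right, ?_, hX', ?_⟩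
  · rw [Submodule.disjoint_def]
    rintro x hx hxT
    obtain ⟨c, hc, d, hd, rfl⟩ := Submodule.mem_sup.1 hx
    have hxX : c + d ∈ X := X.add_mem (hC₀X hc) hd.2
    have hd' : d ∈ C₀ ⊔ T ⊓ X := by
      have := Submodule.sub_mem _ (Submodule.mem_sup_right (S := C₀) (T := T ⊓ X) ⟨hxT, hxX⟩)
        (Submodule.mem_sup_left hc)
      simpa using this
    have hd0 : d = 0 := Submodule.disjoint_def.1 hD.disjoint d hd' hd.1
    subst hd0
    rw [add_zero] at hxT ⊢
    exact Submodule.disjoint_def.1 hC₀T c hc hxT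
  · intro Y hY hYX
    rcases eq_or_lt_of_le hYX with rfl | h
    · rwa [inf_eq_left.2 (sup_le hC₀X inf_le_right)]
    · exact (hC₀ Y hY h).trans (by gcongr; exact le_sup_left)

/-- Every subspace is the image of a projection that preserves a given chain of subspaces. -/
theorem exists_projection_preserving_chain [FiniteDimensional F U] {L : Set (Submodule F U)}
    (hL : IsChain (· ≤ ·) L) (T : Submodule F U) :
    ∃ p : U →ₗ[F] U, (∀ x, p x ∈ T) ∧ (∀ x ∈ T, p x = x) ∧ ∀ X ∈ L, X ≤ X.comap p := by
  obtain ⟨C, -, hCT, hC, hCL⟩ := exists_disjoint_adapted hL T ⊤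
  have h : IsCompl T C := ⟨hCT.symm, codisjoint_iff.2 (by simpa using hC)⟩
  refine ⟨T.projection C h, fun x => T.projection_apply_mem h x,
    fun x hx => Submodule.projection_apply_of_mem_left h hx, fun X hX x hx => ?_⟩
  obtain ⟨t, ht, c, hc, rfl⟩ := Submodule.mem_sup.1 (hCL X hX le_top hx)
  rw [Submodule.mem_comap, map_add, Submodule.projection_apply_of_mem_left h ht.1,
    (Submodule.projection_apply_eq_zero_iff h).2 hc.1, add_zero]
  exact ht.2

theorem LinearMap.exists_quasi_inverse (f : U →ₗ[F] W) :
    ∃ s : W →ₗ[F] U, ∀ x, f (s (f x)) = f x := by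
  obtain ⟨r, hr⟩ := f.rangeRestrict.exists_rightInverse_of_surjective f.range_rangeRestrict
  obtain ⟨s, hs⟩ := r.exists_extend
  refine ⟨s, fun x => ?_⟩
  have h₁ : s (f x) = r (f.rangeRestrict x) := LinearMap.congr_fun hs (f.rangeRestrict x)
  rw [h₁]
  exact congrArg Subtype.val (LinearMap.congr_fun hr (f.rangeRestrict x))

/-- An idempotent of the target that preserves the images of a chain lifts to an idempotent of
the source that preserves the chain. -/
theorem exists_idempotent_lift [FiniteDimensional F U] {L : Set (Submodule F U)}
    (hL : IsChain (· ≤ ·) L) (htop : ⊤ ∈ L) (f : U →ₗ[F] W) {e : W →ₗ[F] W}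
    (he : ∀ x, e (e x) = e x) (heL : ∀ X ∈ L, X.map f ≤ (X.map f).comap e) :
    ∃ e' : U →ₗ[F] U, (∀ x, e' (e' x) = e' x) ∧ (∀ X ∈ L, X ≤ X.comap e') ∧
      ∀ x, f (e' x) = e (f x) := by
  obtain ⟨p, hp₁, hp₂, hpL⟩ := exists_projection_preserving_chain hL (LinearMap.ker f)
  obtain ⟨s, hs⟩ := f.exists_quasi_inverse
  -- `q` projects along `ker f` and preserves the chain, so `q ∘ s` inverts `f` on `range f`
  let q : U →ₗ[F] U := LinearMap.id - p
  have hq : ∀ x, q x = x - p x := fun x => rfl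
  have hfq : ∀ x, f (q x) = f x := fun x => by
    rw [hq, map_sub, LinearMap.mem_ker.1 (hp₁ x), sub_zero]
  have hqs : ∀ x, q (s (f x)) = q x := fun x => by
    have h := hp₂ (s (f x) - x) (by rw [LinearMap.mem_ker, map_sub, hs, sub_self])
    rw [← sub_eq_zero, ← map_sub, hq, h, sub_self]
  have hcomp : ∀ x, f (q (s (e (f x)))) = e (f x) := fun x => by
    obtain ⟨y, -, hy⟩ := heL ⊤ htop ⟨x, trivial, rfl⟩
    rw [← hy, hfq, hs]
  refine ⟨q ∘ₗ s ∘ₗ e ∘ₗ f, fun x => ?_, fun X hX x hx => ?_, hcomp⟩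
  · simp only [LinearMap.comp_apply, hcomp, he]
  · obtain ⟨y, hyX, hy⟩ := heL X hX ⟨x, hx, rfl⟩
    rw [Submodule.mem_comap, LinearMap.comp_apply, LinearMap.comp_apply, LinearMap.comp_apply,
      ← hy, hqs, hq]
    exact X.sub_mem hyX (hpL X hX hyX)

/-- An idempotent of the source that preserves the preimages of a chain descends to an idempotent
of the target that preserves the chain. -/
theorem exists_idempotent_descend [FiniteDimensional F U] {L : Set (Submodule F U)}
    (hL : IsChain (· ≤ ·) L) (hbot : ⊥ ∈ L) (g : W →ₗ[F] U) {e : W →ₗ[F] W}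
    (he : ∀ x, e (e x) = e x) (heL : ∀ X ∈ L, X.comap g ≤ (X.comap g).comap e) :
    ∃ e' : U →ₗ[F] U, (∀ x, e' (e' x) = e' x) ∧ (∀ X ∈ L, X ≤ X.comap e') ∧
      ∀ w, e' (g w) = g (e w) := by
  obtain ⟨p, hp₁, hp₂, hpL⟩ := exists_projection_preserving_chain hL (LinearMap.range g)
  obtain ⟨s, hs⟩ := g.exists_quasi_inverse
  have hcomp : ∀ w, g (e (s (p (g w)))) = g (e w) := fun w => by
    rw [hp₂ _ ⟨w, rfl⟩, ← sub_eq_zero, ← map_sub, ← map_sub]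
    -- `s (g w) - w` lies in `ker g`, which `e` preserves because `ker g` is the preimage of `⊥`
    exact heL ⊥ hbot (x := s (g w) - w) (by simp [hs])
  refine ⟨g ∘ₗ e ∘ₗ s ∘ₗ p, fun x => ?_, fun X hX x hx => ?_, hcomp⟩
  · simp only [LinearMap.comp_apply, hcomp, he]
  · obtain ⟨w, hw⟩ := hp₁ x
    refine heL X hX (x := s (p x)) ?_
    rw [Submodule.mem_comap, ← hw, hs, hw]
    exact hpL X hX hx

/-- For two chains of subspaces of a non-zero space there is an idempotent of rank one that
preserves both. -/
theorem exists_rank_one_idempotent_preserving_chains [FiniteDimensional F U] [Nontrivial U]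
    {L R : Set (Submodule F U)} (hL : IsChain (· ≤ ·) L) (hR : IsChain (· ≤ ·) R)
    (hLtop : ⊤ ∈ L) (hRtop : ⊤ ∈ R) (hRbot : ⊥ ∈ R) :
    ∃ (v : U) (e : U →ₗ[F] U), v ≠ 0 ∧ e v = v ∧ (∀ x, e (e x) = e x) ∧
      (∀ x, e x ∈ Submodule.span F {v}) ∧
      (∀ X ∈ L, X ≤ X.comap e) ∧ (∀ X ∈ R, X ≤ X.comap e) := by
  -- `X₀` is the least non-zero member of `L`, and `Y₀` the least member of `R` that meets `X₀`
  obtain ⟨X₀, ⟨hX₀L, hX₀⟩, hX₀min⟩ := WellFounded.has_min wellFounded_lt {X | X ∈ L ∧ X ≠ ⊥}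
    ⟨⊤, hLtop, top_ne_bot⟩
  obtain ⟨Y₀, ⟨hY₀R, hY₀⟩, hY₀min⟩ := WellFounded.has_min wellFounded_lt
    {Y | Y ∈ R ∧ X₀ ⊓ Y ≠ ⊥} ⟨⊤, hRtop, by simpa using hX₀⟩
  obtain ⟨v, ⟨hvX, hvY⟩, hv⟩ := Submodule.exists_mem_ne_zero_of_ne_bot hY₀
  obtain ⟨Z, ⟨hZR, hZ⟩, hZmax⟩ := WellFounded.has_min wellFounded_gt
    {Y | Y ∈ R ∧ X₀ ⊓ Y = ⊥} ⟨⊥, hRbot, by simp⟩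
  have hvZ : v ∉ Z := fun h => hv ((Submodule.mem_bot F).1 (hZ ▸ ⟨hvX, h⟩))
  obtain ⟨φ₀, hφ₀v, hφ₀⟩ := Submodule.exists_le_ker_of_notMem hvZ
  let φ : U →ₗ[F] F := (φ₀ v)⁻¹ • φ₀
  have hφv : φ v = 1 := inv_mul_cancel₀ hφ₀v
  have hφ : ∀ z ∈ Z, φ z = 0 := fun z hz => by
    have : φ₀ z = 0 := hφ₀ hz
    simp [φ, this]
  refine ⟨v, φ.smulRight v, hv, by simp [hφv], fun x => by simp [hφv],
    fun x => Submodule.smul_mem _ _ (Submodule.mem_span_singleton_self v), ?_, ?_⟩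
  · intro X hX x hx
    rcases eq_or_ne X ⊥ with rfl | hX0
    · rw [(Submodule.mem_bot F).1 hx]; simp
    · refine X.smul_mem _ ?_
      rcases hL.total hX₀L hX with h | h
      · exact h hvX
      · exact (eq_or_lt_of_le h).elim (fun h => h ▸ hvX) fun h => (hX₀min X ⟨hX, hX0⟩ h).elim
  · intro Y hY y hy
    by_cases hXY : X₀ ⊓ Y = ⊥
    · have hYZ : Y ≤ Z := by
        rcases hR.total hY hZR with h | h
        · exact h
        · exact (eq_or_lt_of_le h).elim (fun h => h.ge) fun h => (hZmax Y ⟨hY, hXY⟩ h).elim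
      simp [hφ y (hYZ hy)]
    · refine Y.smul_mem _ ?_
      rcases hR.total hY₀R hY with h | h
      · exact h hvY
      · exact (eq_or_lt_of_le h).elim (fun h => h ▸ hvY) fun h => (hY₀min Y ⟨hY, hXY⟩ h).elim

end LinearAlgebra

/-! ### Families and intervals indexed by the integers -/

/-- A family of sets indexed by `ℤ` with relations between neighbours has a compatible choice of
elements through a given one, if every element can be continued away from the base point `b`. -/
theorem Int.exists_section {α : ℤ → Type*} (R : ∀ k l, α k → α l → Prop) (b : ℤ) (x₀ : α b)
    (up : ∀ k, b ≤ k → ∀ x : α k, ∃ y : α (k + 1), R k (k + 1) x y)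
    (down : ∀ k, k ≤ b → ∀ y : α k, ∃ x : α (k - 1), R (k - 1) k x y) :
    ∃ s : ∀ k, α k, s b = x₀ ∧ ∀ k l, l = k + 1 → R k l (s k) (s l) := by
  choose u hu using up
  choose d hd using down
  refine ⟨fun k => k.inductionOn' b x₀ u d, Int.inductionOn'_self, fun k l h => ?_⟩
  rcases le_or_gt b k with hk | hk
  · subst h
    dsimp only
    rw [Int.inductionOn'_add_one hk]
    exact hu k hk _
  · obtain rfl : k = l - 1 := by omega
    have hl : l ≤ b := by omega
    dsimp only
    rw [Int.inductionOn'_sub_one hl]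
    exact hd l hl _

/-- A convex set of integers is an interval with end points in `ℤ ∪ {±∞}`; the empty set is
`[+∞, +∞]`. -/
theorem Set.OrdConnected.exists_extended_interval {S : Set ℤ} (hS : S.OrdConnected) :
    ∃ a b : WithBot (WithTop ℤ), a ≤ b ∧ ∀ k : ℤ, k ∈ S ↔
      a ≤ ((k : WithTop ℤ) : WithBot (WithTop ℤ)) ∧
        ((k : WithTop ℤ) : WithBot (WithTop ℤ)) ≤ b := by
  rcases S.eq_empty_or_nonempty with rfl | ⟨s, hs⟩
  · refine ⟨⊤, ⊤, le_rfl, fun k => ⟨fun h => h.elim, fun h => ?_⟩⟩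
    have h' : (((⊤ : WithTop ℤ) : WithBot (WithTop ℤ))) ≤ ((k : WithTop ℤ) : WithBot _) := h.1
    rw [WithBot.coe_le_coe, top_le_iff] at h'
    exact (WithTop.coe_ne_top h').elim
  obtain ⟨a, ha⟩ : ∃ a : WithBot (WithTop ℤ), ∀ k : ℤ,
      a ≤ ((k : WithTop ℤ) : WithBot (WithTop ℤ)) ↔ ∃ s ∈ S, s ≤ k := by
    by_cases hb : ∃ b, ∀ z ∈ S, b ≤ z
    · obtain ⟨m, hm, hmin⟩ := Int.exists_least_of_bdd hb ⟨s, hs⟩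
      refine ⟨((m : WithTop ℤ) : WithBot (WithTop ℤ)), fun k => ?_⟩
      rw [WithBot.coe_le_coe, WithTop.coe_le_coe]
      exact ⟨fun h => ⟨m, hm, h⟩, fun ⟨t, ht, htk⟩ => (hmin t ht).trans htk⟩
    · push Not at hb
      exact ⟨⊥, fun k => ⟨fun _ => (hb k).imp fun t ht => ⟨ht.1, ht.2.le⟩, fun _ => bot_le⟩⟩
  obtain ⟨b, hb⟩ : ∃ b : WithBot (WithTop ℤ), ∀ k : ℤ,
      ((k : WithTop ℤ) : WithBot (WithTop ℤ)) ≤ b ↔ ∃ s ∈ S, k ≤ s := by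
    by_cases hb : ∃ b, ∀ z ∈ S, z ≤ b
    · obtain ⟨m, hm, hmax⟩ := Int.exists_greatest_of_bdd hb ⟨s, hs⟩
      refine ⟨((m : WithTop ℤ) : WithBot (WithTop ℤ)), fun k => ?_⟩
      rw [WithBot.coe_le_coe, WithTop.coe_le_coe]
      exact ⟨fun h => ⟨m, hm, h⟩, fun ⟨t, ht, htk⟩ => htk.trans (hmax t ht)⟩
    · push Not at hb
      exact ⟨⊤, fun k => ⟨fun _ => (hb k).imp fun t ht => ⟨ht.1, ht.2.le⟩, fun _ => le_top⟩⟩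
  refine ⟨a, b, ((ha s).2 ⟨s, hs, le_rfl⟩).trans ((hb s).2 ⟨s, hs, le_rfl⟩), fun k => ?_⟩
  rw [ha, hb]
  exact ⟨fun h => ⟨⟨k, h, le_rfl⟩, k, h, le_rfl⟩,
    fun ⟨⟨_, hs, hsk⟩, _, ht, hkt⟩ => hS.out hs ht ⟨hsk, hkt⟩⟩

/-! ### Zigzag modules and their idempotent endomorphisms -/

namespace ZigzagModule

variable {F : Type u} [Field F]

/-- The structure map of `V` along `f`, as a linear map. -/
abbrev lin (V : ZigzagModule F) {i j : ZZ} (f : i ⟶ j) : V.obj i →ₗ[F] V.obj j :=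
  (V.map f).hom.hom

theorem lin_id (V : ZigzagModule F) (i : ZZ) (x : V.obj i) : V.lin (𝟙 i) x = x := by
  simp [lin]

theorem hom_cases {i j : ZZ} (f : i ⟶ j) :
    i = j ∨ j.idx = i.idx + 1 ∨ i.idx = j.idx + 1 := by
  rcases (ZZ.le_def i j).1 (leOfHom f) with h | ⟨-, h | h⟩
  · exact Or.inl h
  · exact Or.inr (Or.inr (by omega))
  · exact Or.inr (Or.inl h)

theorem nonempty_hom_or {i j : ZZ} (h : j.idx = i.idx + 1) :
    Nonempty (i ⟶ j) ∨ Nonempty (j ⟶ i) := by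
  rcases Int.even_or_odd i.idx with hi | hi
  · exact Or.inl ⟨homOfLE ((ZZ.le_def i j).2 (Or.inr ⟨hi, Or.inr h⟩))⟩
  · exact Or.inr ⟨homOfLE ((ZZ.le_def j i).2
      (Or.inr ⟨h ▸ hi.add_one, Or.inl (by omega)⟩))⟩

theorem eq_of_hom_of_hom {i j : ZZ} (f : i ⟶ j) (g : j ⟶ i) : i = j :=
  le_antisymm (leOfHom f) (leOfHom g)

/-- The isomorphism of zigzag modules given by a compatible family of linear equivalences. -/
def isoMk {V W : ZigzagModule F} (e : ∀ i, V.obj i ≃ₗ[F] W.obj i)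
    (he : ∀ {i j} (f : i ⟶ j) x, e j (V.lin f x) = W.lin f (e i x)) : V ≅ W :=
  NatIso.ofComponents
    (fun i => LinearEquiv.toFGModuleCatIso (V := V.obj i) (W := W.obj i) (e i))
    (fun f => by
      ext x
      exact he f x)

/-- The submodule of `V` with spaces `S i`. -/
def sub (V : ZigzagModule F) (S : ∀ i, Submodule F (V.obj i))
    (hS : ∀ {i j} (f : i ⟶ j), S i ≤ (S j).comap (V.lin f)) : ZigzagModule F where
  obj i := FGModuleCat.of F (S i)
  map f := FGModuleCat.ofHom ((V.lin f).restrict (hS f))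
  map_id i := by
    ext x
    exact V.lin_id i x
  map_comp f g := by
    ext x
    exact LinearMap.congr_fun (congrArg (fun h => h.hom.hom) (V.map_comp f g)) x.1

theorem subsingleton_of_isZero {V : ZigzagModule F} (h : IsZero V) (i : ZZ) :
    Subsingleton (V.obj i) := by
  have h' : IsZero (V.obj i) := (Functor.isZero_iff V).1 h i
  have h₀ : 𝟙 (V.obj i) = 0 := h'.eq_of_src _ _
  refine ⟨fun x y => ?_⟩
  have hz : ∀ x : V.obj i, x = 0 := fun x =>
    LinearMap.congr_fun (congrArg (fun h => h.hom.hom) h₀) x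
  rw [hz x, hz y]

/-- An idempotent endomorphism of an indecomposable zigzag module is `0` or the identity, since
the module is the direct sum of its range and its kernel. -/
theorem IsIndecomposable.idempotent_eq {V : ZigzagModule F} (hV : V.IsIndecomposable)
    (e : ∀ i, V.obj i →ₗ[F] V.obj i) (he : ∀ i x, e i (e i x) = e i x)
    (hnat : ∀ {i j} (f : i ⟶ j) x, e j (V.lin f x) = V.lin f (e i x)) :
    (∀ i x, e i x = 0) ∨ ∀ i x, e i x = x := by
  by_contra! hcon
  obtain ⟨⟨i, x, hx⟩, j, y, hy⟩ := hcon
  have hcompl : ∀ i, IsCompl (LinearMap.range (e i)) (LinearMap.ker (e i)) := fun i =>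
    LinearMap.IsIdempotentElem.isCompl (f := e i) (LinearMap.ext (he i))
  let U := V.sub (fun i => LinearMap.range (e i)) (by
    rintro i j f _ ⟨z, rfl⟩
    exact ⟨V.lin f z, hnat f z⟩)
  let W := V.sub (fun i => LinearMap.ker (e i)) (by
    intro i j f z hz
    rw [Submodule.mem_comap, LinearMap.mem_ker, hnat, LinearMap.mem_ker.1 hz, map_zero])
  refine hV ⟨U, W, fun h => hx ?_, fun h => hy ?_, ⟨Iso.symm (isoMk (V := U.directSum W)
    (fun i => Submodule.prodEquivOfIsCompl _ _ (hcompl i)) ?_)⟩⟩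
  · have : Subsingleton (LinearMap.range (e i)) := subsingleton_of_isZero h i
    exact congrArg Subtype.val (Subsingleton.elim (α := LinearMap.range (e i)) ⟨e i x, x, rfl⟩ 0)
  · have : Subsingleton (LinearMap.ker (e j)) := subsingleton_of_isZero h j
    have h₀ := congrArg Subtype.val (Subsingleton.elim (α := LinearMap.ker (e j))
      ⟨e j y - y, by rw [LinearMap.mem_ker, map_sub, he, sub_self]⟩ 0)
    exact sub_eq_zero.1 h₀
  · rintro i j f ⟨a, b⟩
    exact (map_add (V.lin f) a.1 b.1).symm

/-! ### The flags coming from the two sides -/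

/-- The subspaces of the `V.obj i` generated by `⊥` and `⊤` under images and preimages along the
structure maps between positions `k` and `k + d`, in the direction of `d`: for `d = 1` they
record what comes from the left, for `d = -1` what comes from the right. -/
inductive Flag (V : ZigzagModule F) (d : ℤ) : ∀ i : ZZ, Submodule F (V.obj i) → Prop
  | bot (i : ZZ) : Flag V d i ⊥
  | top (i : ZZ) : Flag V d i ⊤
  | map {i j : ZZ} (f : j ⟶ i) (h : i.idx = j.idx + d) {X : Submodule F (V.obj j)}
      (hX : Flag V d j X) : Flag V d i (X.map (V.lin f))
  | comap {i j : ZZ} (f : i ⟶ j) (h : i.idx = j.idx + d) {X : Submodule F (V.obj j)}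
      (hX : Flag V d j X) : Flag V d i (X.comap (V.lin f))

/-- Images and preimages preserve inclusions, and there is only one structure map between
neighbours, so any two members of a flag can be compared by going back along it together. -/
theorem Flag.isChain (V : ZigzagModule F) {d : ℤ} (hd : d ≠ 0) (i : ZZ) :
    IsChain (· ≤ ·) {X | V.Flag d i X} := by
  intro X hX Y hY hXY
  clear hXY
  change X ≤ Y ∨ Y ≤ X
  change V.Flag d i X at hX
  change V.Flag d i Y at hY
  induction hX with
  | bot i => exact Or.inl bot_le
  | top i => exact Or.inr le_top
  | @map i j f h X hX ih =>
    cases hY with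
    | bot => exact Or.inr bot_le
    | top => exact Or.inl le_top
    | @map _ j' f' h' Y hY =>
      obtain rfl : j = j' := ZZ.ext (by omega)
      obtain rfl : f = f' := Subsingleton.elim _ _
      exact (ih hY).imp (fun h => Submodule.map_mono h) (fun h => Submodule.map_mono h)
    | @comap _ j' f' h' Y hY =>
      obtain rfl : j = j' := ZZ.ext (by omega)
      obtain rfl := eq_of_hom_of_hom f f'
      omega
  | @comap i j f h X hX ih =>
    cases hY with
    | bot => exact Or.inr bot_le
    | top => exact Or.inl le_top
    | @map _ j' f' h' Y hY =>
      obtain rfl : j = j' := ZZ.ext (by omega)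
      obtain rfl := eq_of_hom_of_hom f f'
      omega
    | @comap _ j' f' h' Y hY =>
      obtain rfl : j = j' := ZZ.ext (by omega)
      obtain rfl : f = f' := Subsingleton.elim _ _
      exact (ih hY).imp (fun h => Submodule.comap_mono h) (fun h => Submodule.comap_mono h)

/-- Endomorphisms `x` of `V.obj i` and `y` of `V.obj j` commute with the structure maps between
`i` and `j`, whichever way these go. -/
def Compatible (V : ZigzagModule F) (i j : ZZ) (x : V.obj i →ₗ[F] V.obj i)
    (y : V.obj j →ₗ[F] V.obj j) : Prop :=
  (∀ (f : i ⟶ j) a, y (V.lin f a) = V.lin f (x a)) ∧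
    ∀ (f : j ⟶ i) a, x (V.lin f a) = V.lin f (y a)

theorem Compatible.symm {V : ZigzagModule F} {i j : ZZ} {x : V.obj i →ₗ[F] V.obj i}
    {y : V.obj j →ₗ[F] V.obj j} (h : V.Compatible i j x y) : V.Compatible j i y x :=
  ⟨h.2, h.1⟩

/-- An idempotent that preserves the flag at `i` extends one step towards the side that the flag
comes from, to an idempotent that preserves the flag there. -/
theorem exists_compatible_idempotent (V : ZigzagModule F) {d : ℤ} (hd : d = 1 ∨ d = -1) {i j : ZZ}
    (hij : i.idx = j.idx + d) {e : V.obj i →ₗ[F] V.obj i} (he : ∀ x, e (e x) = e x)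
    (heF : ∀ X, V.Flag d i X → X ≤ X.comap e) :
    ∃ e' : V.obj j →ₗ[F] V.obj j, (∀ x, e' (e' x) = e' x) ∧
      (∀ X, V.Flag d j X → X ≤ X.comap e') ∧ V.Compatible i j e e' := by
  have hd0 : d ≠ 0 := by omega
  have hij' : Nonempty (i ⟶ j) ∨ Nonempty (j ⟶ i) := by
    rcases hd with rfl | rfl
    · exact (nonempty_hom_or hij).symm
    · exact nonempty_hom_or (by omega)
  have hne : i ≠ j := by rintro rfl; omega
  rcases hij' with ⟨⟨g⟩⟩ | ⟨⟨f⟩⟩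
  · obtain ⟨e', h₁, h₂, h₃⟩ := exists_idempotent_descend (Flag.isChain V hd0 j) (Flag.bot j)
      (V.lin g) he (fun X hX => heF _ (Flag.comap g hij hX))
    refine ⟨e', h₁, h₂, fun g' a => ?_, fun f _ => (hne (eq_of_hom_of_hom g f)).elim⟩
    obtain rfl : g = g' := Subsingleton.elim _ _
    exact h₃ a
  · obtain ⟨e', h₁, h₂, h₃⟩ := exists_idempotent_lift (Flag.isChain V hd0 j) (Flag.top j)
      (V.lin f) he (fun X hX => heF _ (Flag.map f hij hX))
    refine ⟨e', h₁, h₂, fun g _ => (hne (eq_of_hom_of_hom g f)).elim, fun f' a => ?_⟩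
    obtain rfl : f = f' := Subsingleton.elim _ _
    exact (h₃ a).symm

/-- An idempotent of `V.obj ⟨b⟩` that preserves both flags extends to an idempotent endomorphism
of `V`. -/
theorem exists_idempotent_extension (V : ZigzagModule F) (b : ℤ)
    {e₀ : V.obj ⟨b⟩ →ₗ[F] V.obj ⟨b⟩} (he₀ : ∀ x, e₀ (e₀ x) = e₀ x)
    (hl : ∀ X, V.Flag 1 ⟨b⟩ X → X ≤ X.comap e₀) (hr : ∀ X, V.Flag (-1) ⟨b⟩ X → X ≤ X.comap e₀) :
    ∃ e : ∀ i, V.obj i →ₗ[F] V.obj i, e ⟨b⟩ = e₀ ∧ (∀ i x, e i (e i x) = e i x) ∧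
      ∀ {i j} (f : i ⟶ j) x, e j (V.lin f x) = V.lin f (e i x) := by
  -- the left flag is needed only to the left of `b`, the right flag only to the right of it
  let α : ℤ → Type u := fun k => {e : V.obj ⟨k⟩ →ₗ[F] V.obj ⟨k⟩ // (∀ x, e (e x) = e x) ∧
    (k ≤ b → ∀ X, V.Flag 1 ⟨k⟩ X → X ≤ X.comap e) ∧
    (b ≤ k → ∀ X, V.Flag (-1) ⟨k⟩ X → X ≤ X.comap e)}
  obtain ⟨s, hs₀, hs⟩ := Int.exists_section (α := α)
    (fun k l x y => V.Compatible ⟨k⟩ ⟨l⟩ x.1 y.1) b ⟨e₀, he₀, fun _ => hl, fun _ => hr⟩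
    (fun k hk x => by
      obtain ⟨y, h₁, h₂, h₃⟩ := V.exists_compatible_idempotent (d := -1) (Or.inr rfl)
        (i := ⟨k⟩) (j := ⟨k + 1⟩) (by simp) x.2.1 (x.2.2.2 hk)
      exact ⟨⟨y, h₁, fun h => by omega, fun _ => h₂⟩, h₃⟩)
    (fun k hk x => by
      obtain ⟨y, h₁, h₂, h₃⟩ := V.exists_compatible_idempotent (d := 1) (Or.inl rfl)
        (i := ⟨k⟩) (j := ⟨k - 1⟩) (by simp) x.2.1 (x.2.2.1 hk)
      exact ⟨⟨y, h₁, fun _ => h₂, fun h => by omega⟩, h₃.symm⟩)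
  refine ⟨fun i => (s i.idx).1, congrArg Subtype.val hs₀, fun i => (s i.idx).2.1,
    fun {i j} f x => ?_⟩
  rcases hom_cases f with rfl | h | h
  · obtain rfl : f = 𝟙 i := Subsingleton.elim _ _
    rw [lin_id, lin_id]
  · exact (hs _ _ h).1 f x
  · exact (hs _ _ h).2 f x

/-! ### The shape of an indecomposable module -/

/-- The spaces of an indecomposable zigzag module have dimension at most one. -/
theorem IsIndecomposable.exists_eq_smul {V : ZigzagModule F} (hV : V.IsIndecomposable) (i : ZZ)
    {x : V.obj i} (hx : x ≠ 0) (y : V.obj i) : ∃ c : F, y = c • x := by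
  have : Nontrivial (V.obj i) := ⟨x, 0, hx⟩
  obtain ⟨v, e₀, hv, hev, he₀, hspan, hl, hr⟩ := exists_rank_one_idempotent_preserving_chains
    (Flag.isChain V one_ne_zero i) (Flag.isChain V (neg_ne_zero.2 one_ne_zero) i)
    (Flag.top i) (Flag.top i) (Flag.bot i)
  obtain ⟨e, he, hidem, hnat⟩ := V.exists_idempotent_extension i.idx he₀ hl hr
  change e i = e₀ at he
  rcases hV.idempotent_eq e hidem hnat with h | h
  · exact (hv (by rw [← hev, ← he, h])).elim
  · have hmem : ∀ z : V.obj i, ∃ c : F, c • v = z := fun z =>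
      Submodule.mem_span_singleton.1 (by simpa only [← he, h] using hspan z)
    obtain ⟨c, rfl⟩ := hmem x
    obtain ⟨d, rfl⟩ := hmem y
    have hc : c ≠ 0 := by rintro rfl; simp at hx
    exact ⟨d * c⁻¹, by rw [smul_smul, inv_mul_cancel_right₀ hc]⟩

/-- If the structure map between `k` and `k + 1` vanishes, then truncation at `k` is an idempotent
endomorphism, so an indecomposable module lives on one side of `k`. -/
theorem IsIndecomposable.subsingleton_of_lin_eq_zero {V : ZigzagModule F}
    (hV : V.IsIndecomposable) (k : ℤ)
    (h₁ : ∀ {i j} (f : i ⟶ j), i.idx = k → j.idx = k + 1 → V.lin f = 0)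
    (h₂ : ∀ {i j} (f : i ⟶ j), i.idx = k + 1 → j.idx = k → V.lin f = 0) :
    (∀ i, i.idx ≤ k → Subsingleton (V.obj i)) ∨ ∀ i, k < i.idx → Subsingleton (V.obj i) := by
  classical
  have hnat : ∀ {i j : ZZ} (f : i ⟶ j) (x : V.obj i),
      (if j.idx ≤ k then LinearMap.id else 0 : V.obj j →ₗ[F] V.obj j) (V.lin f x) =
        V.lin f ((if i.idx ≤ k then LinearMap.id else 0 : V.obj i →ₗ[F] V.obj i) x) := by
    intro i j f x
    by_cases hi : i.idx ≤ k <;> by_cases hj : j.idx ≤ k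
    · simp only [if_pos hi, if_pos hj, LinearMap.id_apply]
    · have hf : V.lin f = 0 := by
        rcases hom_cases f with rfl | h | h
        · exact (hj hi).elim
        · exact h₁ f (by omega) (by omega)
        · omega
      simp only [hf, LinearMap.zero_apply, map_zero]
    · have hf : V.lin f = 0 := by
        rcases hom_cases f with rfl | h | h
        · exact (hi hj).elim
        · omega
        · exact h₂ f (by omega) (by omega)
      simp only [hf, LinearMap.zero_apply, map_zero]
    · simp only [if_neg hi, if_neg hj, LinearMap.zero_apply, map_zero]
  rcases hV.idempotent_eq (fun i => if i.idx ≤ k then LinearMap.id else 0)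
    (fun i x => by split_ifs <;> rfl) hnat with h | h
  · refine Or.inl fun i hi => ⟨fun x y => ?_⟩
    have hz : ∀ z : V.obj i, z = 0 := fun z => by
      simpa only [if_pos hi, LinearMap.id_apply] using h i z
    rw [hz x, hz y]
  · refine Or.inr fun i hi => ⟨fun x y => ?_⟩
    have hz : ∀ z : V.obj i, z = 0 := fun z => by
      simpa only [if_neg hi.not_ge, LinearMap.zero_apply, eq_comm] using h i z
    rw [hz x, hz y]

theorem IsIndecomposable.lin_ne_zero {V : ZigzagModule F} (hV : V.IsIndecomposable) {i j : ZZ}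
    (f : i ⟶ j) [Nontrivial (V.obj i)] [Nontrivial (V.obj j)] : V.lin f ≠ 0 := by
  intro hf
  rcases hom_cases f with rfl | h | h
  · obtain ⟨x, hx⟩ := exists_ne (0 : V.obj i)
    obtain rfl : f = 𝟙 i := Subsingleton.elim _ _
    exact hx (by rw [← V.lin_id i x, hf, LinearMap.zero_apply])
  · rcases hV.subsingleton_of_lin_eq_zero i.idx (fun {i' j'} f' hi hj => by
      obtain rfl : i' = i := ZZ.ext hi
      obtain rfl : j' = j := ZZ.ext (hj.trans h.symm)
      exact (Subsingleton.elim f' f) ▸ hf) (fun {i' j'} f' hi hj => by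
      obtain rfl : i' = j := ZZ.ext (hi.trans h.symm)
      obtain rfl : j' = i := ZZ.ext hj
      obtain rfl := eq_of_hom_of_hom f f'
      omega) with h' | h'
    · exact not_subsingleton _ (h' i le_rfl)
    · exact not_subsingleton _ (h' j (by omega))
  · rcases hV.subsingleton_of_lin_eq_zero j.idx (fun {i' j'} f' hi hj => by
      obtain rfl : i' = j := ZZ.ext hi
      obtain rfl : j' = i := ZZ.ext (hj.trans h.symm)
      obtain rfl := eq_of_hom_of_hom f f'
      omega) (fun {i' j'} f' hi hj => by
      obtain rfl : i' = i := ZZ.ext (hi.trans h.symm)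
      obtain rfl : j' = j := ZZ.ext hj
      exact (Subsingleton.elim f' f) ▸ hf) with h' | h'
    · exact not_subsingleton _ (h' j le_rfl)
    · exact not_subsingleton _ (h' i (by omega))

/-- At a gap in the support the neighbouring structure map vanishes, so nothing lives on one side
of it. -/
theorem IsIndecomposable.ordConnected_support {V : ZigzagModule F} (hV : V.IsIndecomposable) :
    {k : ℤ | Nontrivial (V.obj ⟨k⟩)}.OrdConnected := by
  refine ⟨fun x hx y hy z hz => ?_⟩
  by_contra hzS
  have hzS' : ∀ i : ZZ, i.idx = z → Subsingleton (V.obj i) := by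
    rintro i rfl
    exact not_nontrivial_iff_subsingleton.1 hzS
  have hx' : Nontrivial (V.obj ⟨x⟩) := hx
  have hy' : Nontrivial (V.obj ⟨y⟩) := hy
  have hne : z ≠ y := by rintro rfl; exact hzS hy
  rcases hV.subsingleton_of_lin_eq_zero z
    (fun {i j} f hi _ => by
      have := hzS' i hi
      exact LinearMap.ext fun a => by rw [Subsingleton.elim a 0, map_zero, map_zero])
    (fun {i j} f _ hj => by
      have := hzS' j hj
      exact LinearMap.ext fun a => Subsingleton.elim _ _) with h | h
  · exact not_subsingleton _ (h ⟨x⟩ hz.1)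
  · exact not_subsingleton _ (h ⟨y⟩ (lt_of_le_of_ne hz.2 hne))

/-! ### Comparison with interval modules -/

/-- Families of elements `v` and `w` generating each space of `V` and of `W`, that vanish at the
same positions and are otherwise carried to each other by the structure maps, give `V ≅ W`. -/
theorem nonempty_iso_of_generators {V W : ZigzagModule F} (v : ∀ i, V.obj i) (w : ∀ i, W.obj i)
    (hv : ∀ i x, ∃ c : F, x = c • v i) (hw : ∀ i x, ∃ c : F, x = c • w i)
    (h₀ : ∀ i, v i = 0 ↔ w i = 0)
    (hvmap : ∀ {i j} (f : i ⟶ j), v i ≠ 0 → v j ≠ 0 → V.lin f (v i) = v j)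
    (hwmap : ∀ {i j} (f : i ⟶ j), w i ≠ 0 → w j ≠ 0 → W.lin f (w i) = w j) :
    Nonempty (V ≅ W) := by
  have hgen : ∀ (X : ZigzagModule F) (i : ZZ) (x : X.obj i), (∀ y, ∃ c : F, y = c • x) → x ≠ 0 →
      Function.Bijective (LinearMap.toSpanSingleton F (X.obj i) x) := fun X i x h hx =>
    ⟨fun c d hcd => smul_left_injective F hx hcd, fun y => (h y).imp fun c hc => hc.symm⟩
  have hzero : ∀ (X : ZigzagModule F) (i : ZZ) (x : X.obj i), (∀ y, ∃ c : F, y = c • x) → x = 0 →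
      ∀ y : X.obj i, y = 0 := fun X i x h hx y => by
    obtain ⟨c, rfl⟩ := h y
    rw [hx, smul_zero]
  have hequiv : ∀ i, ∃ g : V.obj i ≃ₗ[F] W.obj i, g (v i) = w i := by
    intro i
    by_cases hi : v i = 0
    · have hV := hzero V i (v i) (hv i) hi
      have hW := hzero W i (w i) (hw i) ((h₀ i).1 hi)
      exact ⟨LinearEquiv.ofLinearMap 0 0 (LinearMap.ext fun y => (hW y).symm ▸ rfl)
        (LinearMap.ext fun y => (hV y).symm ▸ rfl), (hW _).trans (hW _).symm⟩
    · refine ⟨(LinearEquiv.ofBijective _ (hgen V i (v i) (hv i) hi)).symm.trans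
        (LinearEquiv.ofBijective _ (hgen W i (w i) (hw i) (mt (h₀ i).2 hi))), ?_⟩
      have h₁ : (LinearEquiv.ofBijective _ (hgen V i (v i) (hv i) hi)).symm (v i) = 1 := by
        rw [LinearEquiv.symm_apply_eq]
        exact (one_smul F (v i)).symm
      rw [LinearEquiv.trans_apply, h₁]
      exact one_smul F (w i)
  choose g hg using hequiv
  refine ⟨isoMk g fun {i j} f x => ?_⟩
  obtain ⟨c, rfl⟩ := hv i x
  simp only [map_smul, hg]
  congr 1
  by_cases hj : w j = 0
  · rw [hzero W j _ (hw j) hj (g j _), hzero W j _ (hw j) hj (W.lin f _)]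
  by_cases hi : w i = 0
  · rw [hi, (h₀ i).2 hi, map_zero, map_zero, map_zero]
  · rw [hvmap f (mt (h₀ i).1 hi) (mt (h₀ j).1 hj), hg, hwmap f hi hj]

/-- The generator `1` of a space equal to `F`. -/
noncomputable def oneOf {X : FGModuleCat.{u} F} (hX : X = FGModuleCat.of F F) : X :=
  (eqToHom hX.symm).hom.hom (1 : F)

theorem oneOf_ne_zero {X : FGModuleCat.{u} F} (hX : X = FGModuleCat.of F F) : oneOf hX ≠ 0 := by
  subst hX
  exact one_ne_zero (α := F)

theorem exists_eq_smul_oneOf {X : FGModuleCat.{u} F} (hX : X = FGModuleCat.of F F) (x : X) :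
    ∃ c : F, x = c • oneOf hX := by
  subst hX
  exact ⟨x, (mul_one (M := F) x).symm⟩

theorem eqToHom_oneOf {X Y : FGModuleCat.{u} F} (hX : X = FGModuleCat.of F F)
    (hY : Y = FGModuleCat.of F F) : (eqToHom (hX.trans hY.symm)).hom.hom (oneOf hX) = oneOf hY := by
  subst hX
  subst hY
  rfl

variable (F) in
open Classical in
/-- The generator of the space of `interval F a b` at `i`: the element `1` inside the interval,
and `0` outside. -/
noncomputable def intervalGen (a b : WithBot (WithTop ℤ)) (i : ZZ) : (interval F a b).obj i :=
  if h : InInterval a b i then oneOf (intervalObj_of_mem (F := F) h) else 0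

theorem intervalGen_of_mem {a b : WithBot (WithTop ℤ)} {i : ZZ} (h : InInterval a b i) :
    intervalGen F a b i = oneOf (intervalObj_of_mem (F := F) h) := dif_pos h

theorem intervalGen_eq_zero_iff {a b : WithBot (WithTop ℤ)} {i : ZZ} :
    intervalGen F a b i = 0 ↔ ¬ InInterval a b i :=
  ⟨fun h₀ h => oneOf_ne_zero (intervalObj_of_mem (F := F) h) ((intervalGen_of_mem h).symm.trans h₀),
    fun h => dif_neg h⟩

theorem exists_eq_smul_intervalGen (a b : WithBot (WithTop ℤ)) (i : ZZ)
    (x : (interval F a b).obj i) : ∃ c : F, x = c • intervalGen F a b i := by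
  by_cases h : InInterval a b i
  · rw [intervalGen_of_mem h]
    exact exists_eq_smul_oneOf (intervalObj_of_mem (F := F) h) x
  · exact ⟨0, (subsingleton_intervalObj (F := F) h).elim _ _⟩

theorem lin_intervalGen {a b : WithBot (WithTop ℤ)} {i j : ZZ} (f : i ⟶ j)
    (hi : InInterval a b i) (hj : InInterval a b j) :
    (interval F a b).lin f (intervalGen F a b i) = intervalGen F a b j := by
  rw [intervalGen_of_mem hi, intervalGen_of_mem hj]
  have hmap : (interval F a b).map f = eqToHom
      ((intervalObj_of_mem (F := F) hi).trans (intervalObj_of_mem (F := F) hj).symm) :=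
    dif_pos ⟨hi, hj⟩
  rw [lin, hmap]
  exact eqToHom_oneOf _ _

theorem IsIndecomposable.lin_apply_ne_zero {V : ZigzagModule F} (hV : V.IsIndecomposable) {i j : ZZ}
    (f : i ⟶ j) {x : V.obj i} (hx : x ≠ 0) [Nontrivial (V.obj j)] : V.lin f x ≠ 0 := by
  have : Nontrivial (V.obj i) := ⟨x, 0, hx⟩
  refine fun h => hV.lin_ne_zero f (LinearMap.ext fun y => ?_)
  obtain ⟨c, rfl⟩ := hV.exists_eq_smul i hx y
  rw [map_smul, h, smul_zero, LinearMap.zero_apply]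

/-- A generator at `i` determines a generator at a neighbouring position `j`. -/
theorem IsIndecomposable.exists_generator_step {V : ZigzagModule F} (hV : V.IsIndecomposable)
    {i j : ZZ} (hij : j.idx = i.idx + 1 ∨ i.idx = j.idx + 1) (x : V.obj i) :
    ∃ y : V.obj j, (y = 0 → Subsingleton (V.obj j)) ∧
      (∀ f : i ⟶ j, x ≠ 0 → y ≠ 0 → V.lin f x = y) ∧
      ∀ f : j ⟶ i, y ≠ 0 → x ≠ 0 → V.lin f y = x := by
  have hne : i ≠ j := by rintro rfl; omega
  rcases subsingleton_or_nontrivial (V.obj j) with hj | hj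
  · exact ⟨0, fun _ => hj, fun f _ h => (h rfl).elim, fun f h => (h rfl).elim⟩
  obtain ⟨y, hy⟩ := exists_ne (0 : V.obj j)
  by_cases hx : x = 0
  · exact ⟨y, fun h => (hy h).elim, fun f h => (h hx).elim, fun f _ h => (h hx).elim⟩
  have : Nontrivial (V.obj i) := ⟨x, 0, hx⟩
  have hhom : Nonempty (i ⟶ j) ∨ Nonempty (j ⟶ i) :=
    hij.elim nonempty_hom_or fun h => (nonempty_hom_or h).symm
  rcases hhom with ⟨⟨f⟩⟩ | ⟨⟨f⟩⟩
  · refine ⟨V.lin f x, fun h => (hV.lin_apply_ne_zero f hx h).elim, fun f' _ _ => ?_,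
      fun g => (hne (eq_of_hom_of_hom f g)).elim⟩
    rw [Subsingleton.elim f' f]
  · obtain ⟨c, hc⟩ := hV.exists_eq_smul i (hV.lin_apply_ne_zero f hy) x
    refine ⟨c • y, fun h => (hx ?_).elim, fun g => (hne (eq_of_hom_of_hom g f)).elim,
      fun f' _ _ => ?_⟩
    · rw [hc, ← map_smul, h, map_zero]
    · rw [Subsingleton.elim f' f, map_smul, hc]

/-- An indecomposable module has a family of generators compatible with the structure maps. -/
theorem IsIndecomposable.exists_generators {V : ZigzagModule F} (hV : V.IsIndecomposable) :
    ∃ v : ∀ i, V.obj i, (∀ i, v i = 0 → Subsingleton (V.obj i)) ∧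
      ∀ {i j} (f : i ⟶ j), v i ≠ 0 → v j ≠ 0 → V.lin f (v i) = v j := by
  obtain ⟨v₀, hv₀⟩ : ∃ v : V.obj ⟨0⟩, v = 0 → Subsingleton (V.obj ⟨0⟩) := by
    rcases subsingleton_or_nontrivial (V.obj ⟨0⟩) with h | h
    · exact ⟨0, fun _ => h⟩
    · exact (exists_ne (0 : V.obj ⟨0⟩)).imp fun v hv h => (hv h).elim
  obtain ⟨s, -, hs⟩ := Int.exists_section
    (α := fun k => {v : V.obj ⟨k⟩ // v = 0 → Subsingleton (V.obj ⟨k⟩)})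
    (fun k l x y => (∀ f : (⟨k⟩ : ZZ) ⟶ ⟨l⟩, x.1 ≠ 0 → y.1 ≠ 0 → V.lin f x.1 = y.1) ∧
      ∀ f : (⟨l⟩ : ZZ) ⟶ ⟨k⟩, y.1 ≠ 0 → x.1 ≠ 0 → V.lin f y.1 = x.1) 0 ⟨v₀, hv₀⟩
    (fun k _ x => by
      obtain ⟨y, h₁, h₂, h₃⟩ := hV.exists_generator_step (i := ⟨k⟩) (j := ⟨k + 1⟩)
        (Or.inl rfl) x.1
      exact ⟨⟨y, h₁⟩, h₂, h₃⟩)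
    (fun k _ x => by
      obtain ⟨y, h₁, h₂, h₃⟩ := hV.exists_generator_step (i := ⟨k⟩) (j := ⟨k - 1⟩)
        (Or.inr (by simp)) x.1
      exact ⟨⟨y, h₁⟩, h₃, h₂⟩)
  refine ⟨fun i => (s i.idx).1, fun i => (s i.idx).2, fun {i j} f hi hj => ?_⟩
  rcases hom_cases f with rfl | h | h
  · obtain rfl : f = 𝟙 i := Subsingleton.elim _ _
    rw [lin_id]
  · exact (hs _ _ h).1 f hi hj
  · exact (hs _ _ h).2 f hi hj

end ZigzagModule

theorem mainTheorem1 {F : Type u} [Field F] (V : ZigzagModule F) (hV : V.IsIndecomposable) :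
    ∃ a b : WithBot (WithTop ℤ), a ≤ b ∧ Nonempty (V ≅ ZigzagModule.interval F a b) := by
  obtain ⟨a, b, hab, hS⟩ := hV.ordConnected_support.exists_extended_interval
  obtain ⟨v, hv₀, hv⟩ := hV.exists_generators
  refine ⟨a, b, hab, ZigzagModule.nonempty_iso_of_generators v (ZigzagModule.intervalGen F a b)
    (fun i x => ?_) (ZigzagModule.exists_eq_smul_intervalGen a b) (fun i => ?_) hv
    fun f hi hj => ZigzagModule.lin_intervalGen f
      (not_not.1 (mt ZigzagModule.intervalGen_eq_zero_iff.2 hi))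
      (not_not.1 (mt ZigzagModule.intervalGen_eq_zero_iff.2 hj))⟩
  · by_cases hi : v i = 0
    · exact ⟨0, (hv₀ i hi).elim _ _⟩
    · exact hV.exists_eq_smul i hi x
  · rw [ZigzagModule.intervalGen_eq_zero_iff]
    exact ⟨fun h hi => not_subsingleton_iff_nontrivial.2 ((hS i.idx).2 hi) (hv₀ i h),
      fun h => by_contra fun hi => h ((hS i.idx).1 ⟨v i, 0, hi⟩)⟩
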